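/- Let $k$ be a local field of characteristic zero, i.e. $\mathbb R$ or $\mathbb C$ with the usual absolute value, or a non-archimedean locally compact, non-trivially valued field of characteristic zero. All topological $k$-vector spaces are locally convex. An (FN)-space is a nuclear Fréchet space over $k$ (complete, metrizable, locally convex, and nuclear: for every continuous seminorm $p$ there is a continuous seminorm $q\ge p$ such that the canonical map between the completions of $(V,q)$ and $(V,p)$ is nuclear; over a non-archimedean $k$ seminorms are required to satisfy the strong triangle inequality). A (DFN)-space is a space isomorphic to the strong dual of an (FN)-space. A topological vector space $V$ is an analytic Tate space if $V=L\oplus G$ topologically for some subspaces $L,G\subset V$ such that, with the induced topologies, $L$ is an (FN)-space and $G$ is a (DFN)-space; the subspaces $L$ (respectively $G$) which occur in such a decomposition are called the (FN)-lattices (respectively (DFN)-lattices) of $V$. **Corollary.** Let $V$ be an analytic Tate space. If $L$ is an (FN)-lattice and $G$ is a (DFN)-lattice in $V$ (not necessarily belonging to the same decomposition), then $L\cap G$ is finite dimensional and $L+G$ has finite codimension in $V$. -/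

import Mathlib

open Topology

noncomputable section

universe u v w

/-- A local field of characteristic zero, with its absolute value: either `ℝ` or `ℂ` with the usual
absolute value, or a non-archimedean locally compact field of characteristic zero. -/
class IsLocalFieldCharZero (k : Type u) [NontriviallyNormedField k] : Prop where
  charZero : CharZero k
  locallyCompact : LocallyCompactSpace k
  archimedean_or : (∃ e : k ≃+* ℝ, Isometry e) ∨ (∃ e : k ≃+* ℂ, Isometry e) ∨ IsUltrametricDist k

section Seminorms

variable {k : Type u} [NontriviallyNormedField k] {V : Type v} [AddCommGroup V] [Module k V]

/-- The seminorms used over `k`: over an archimedean field all seminorms, over a non-archimedean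
field those that satisfy the strong triangle inequality. -/
def Seminorm.IsAdmissible (p : Seminorm k V) : Prop :=
  IsUltrametricDist k → ∀ x y, p (x + y) ≤ max (p x) (p y)

/-- The vector space `V`, to be seen as a seminormed space through `p`. -/
def SeminormedBy (_p : Seminorm k V) : Type v := V

instance (p : Seminorm k V) : AddCommGroup (SeminormedBy p) := inferInstanceAs (AddCommGroup V)

instance (p : Seminorm k V) : Module k (SeminormedBy p) := inferInstanceAs (Module k V)

instance (p : Seminorm k V) : SeminormedAddCommGroup (SeminormedBy p) :=
  AddGroupSeminorm.toSeminormedAddCommGroup (E := SeminormedBy p) p.toAddGroupSeminorm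

theorem SeminormedBy.norm_def (p : Seminorm k V) (x : SeminormedBy p) :
    ‖x‖ = p (show V from x) := rfl

instance (p : Seminorm k V) : NormedSpace k (SeminormedBy p) where
  norm_smul_le a x := (map_smul_eq_mul p a (show V from x)).le

/-- The local Banach space of `V` at `p`: the Hausdorff completion of `(V, p)`. -/
abbrev LocalBanach (p : Seminorm k V) : Type v := UniformSpace.Completion (SeminormedBy p)

/-- For `p ≤ q`, the identity of `V` as a continuous linear map `(V, q) → (V, p)`. -/
def SeminormedBy.map {p q : Seminorm k V} (h : p ≤ q) : SeminormedBy q →L[k] SeminormedBy p :=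
  LinearMap.mkContinuous
    { toFun := fun x => x, map_add' := fun _ _ => rfl, map_smul' := fun _ _ => rfl } 1
    (fun x => by rw [one_mul]; exact h x)

/-- For `p ≤ q`, the canonical map `LocalBanach q → LocalBanach p`. -/
def LocalBanach.map {p q : Seminorm k V} (h : p ≤ q) : LocalBanach q →L[k] LocalBanach p :=
  (SeminormedBy.map h).completion

end Seminorms

/-- A nuclear map between Banach spaces over `k`: a map `x ↦ ∑ₙ lₙ(x) yₙ`, where the series
`∑ₙ lₙ ⊗ yₙ` converges absolutely or, over a non-archimedean field, has terms tending to zero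
(that is, the map is in the image of the completed projective tensor product `E* ⊗ F`). -/
def IsNuclearMap {k : Type u} [NontriviallyNormedField k] {E : Type v} [NormedAddCommGroup E]
    [NormedSpace k E] {F : Type w} [NormedAddCommGroup F] [NormedSpace k F] (f : E →L[k] F) :
    Prop :=
  ∃ (l : ℕ → E →L[k] k) (y : ℕ → F),
    (Summable (fun n => ‖l n‖ * ‖y n‖) ∨
      (IsUltrametricDist k ∧ Filter.Tendsto (fun n => ‖l n‖ * ‖y n‖) Filter.atTop (𝓝 0))) ∧
    ∀ x, HasSum (fun n => l n x • y n) (f x)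

section Spaces

variable (k : Type u) [NontriviallyNormedField k] (V : Type v) [AddCommGroup V] [Module k V]
  [TopologicalSpace V]

/-- A locally convex topological vector space over `k`. -/
structure IsLocallyConvexTVS : Prop where
  isTopologicalAddGroup : IsTopologicalAddGroup V
  continuousSMul : ContinuousSMul k V
  exists_seminorm : ∀ U ∈ 𝓝 (0 : V),
    ∃ p : Seminorm k V, p.IsAdmissible ∧ Continuous p ∧ {x | p x < 1} ⊆ U

/-- Nuclearity: every continuous seminorm `p` is dominated by a continuous seminorm `q` such that
the canonical map of local Banach spaces is nuclear. -/
def IsNuclearTVS : Prop :=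
  ∀ p : Seminorm k V, p.IsAdmissible → Continuous p →
    ∃ q : Seminorm k V, q.IsAdmissible ∧ Continuous q ∧
      ∃ h : p ≤ q, IsNuclearMap (LocalBanach.map h)

/-- A Fréchet space: a locally convex space that is metrizable and complete. -/
structure IsFrechetTVS : Prop extends IsLocallyConvexTVS k V where
  metrizable : TopologicalSpace.MetrizableSpace V
  complete : @CompleteSpace V (IsTopologicalAddGroup.rightUniformSpace V)

/-- An (FN)-space: a nuclear Fréchet space. -/
structure IsFNSpace : Prop extends IsFrechetTVS k V where
  nuclear : IsNuclearTVS k V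

/-- A (DFN)-space: a space isomorphic to the strong dual of an (FN)-space `F`; Mathlib's topology
on `F →L[k] k` is that of uniform convergence on bounded sets. The universe of `F` is no
restriction: `F` is reflexive, hence isomorphic to the strong dual of `V`, which lives there. -/
def IsDFNSpace : Prop :=
  ∃ (F : Type (max u v)) (_ : AddCommGroup F) (_ : Module k F) (_ : TopologicalSpace F),
    IsFNSpace k F ∧ Nonempty (V ≃L[k] (F →L[k] k))

/-- An analytic Tate space: a locally convex space that is the topological direct sum of an
(FN)-subspace and a (DFN)-subspace. -/
def IsAnalyticTateSpace : Prop :=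
  IsLocallyConvexTVS k V ∧
    ∃ L G : Submodule k V, IsFNSpace k L ∧ IsDFNSpace k G ∧ Submodule.IsTopCompl L G

variable {k V}

/-- An (FN)-lattice: the (FN)-summand in a decomposition of `V` as a topological direct sum of an
(FN)-subspace and a (DFN)-subspace. -/
def IsFNLattice (L : Submodule k V) : Prop :=
  IsFNSpace k L ∧ ∃ G : Submodule k V, IsDFNSpace k G ∧ Submodule.IsTopCompl L G

/-- A (DFN)-lattice: the (DFN)-summand in such a decomposition. -/
def IsDFNLattice (G : Submodule k V) : Prop :=
  IsDFNSpace k G ∧ ∃ L : Submodule k V, IsFNSpace k L ∧ Submodule.IsTopCompl L G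

end Spaces

end

/-!
Let `P` and `Q` be the projections onto `L` and `G` along complements from the given decompositions.
Then `1 - P Q` vanishes on `L ∩ G`, and `1 - (1 - Q)(1 - P) = P + Q (1 - P)` has its range in
`L + G`, so it is enough that both operators are invertible modulo finite rank. Swapping the
factors, `1 - f g ↔ 1 - g f`, replaces each product of projections by an endomorphism of an
(FN)-space that factors through a (DFN)-space. By Baire's theorem the map from the (FN)-space to the
strong dual of another one is bounded on a neighbourhood of zero, so a second swap moves the
endomorphism to a local Banach space, where by nuclearity it is a norm limit of operators of finite
rank.
-/

open Bornology Filter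
open scoped LinearMap.FiniteRangeSetoid

section QuasiInverse

variable {R M N : Type*} [CommRing R] [AddCommGroup M] [Module R M] [AddCommGroup N] [Module R N]

/-- The linear map `u` is invertible modulo linear maps with noetherian range. Over a field this is
the algebraic form of the Fredholm property: no topology is involved, so it can be moved freely
between a topological vector space and its local Banach spaces. -/
def HasQuasiInverse (u : M →ₗ[R] N) : Prop :=
  ∃ v : N →ₗ[R] M, v.IsQuasiInverse u

namespace HasQuasiInverse

variable {u : M →ₗ[R] N}

theorem finite_ker (hu : HasQuasiInverse u) : Module.Finite R u.ker := by
  obtain ⟨v, hvu, -⟩ := hu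
  have := (LinearMap.FiniteRangeSetoid.equiv_iff_hasNoetherianRange.mp hvu).isNoetherian_range
  have hle : u.ker ≤ (v ∘ₗ u - LinearMap.id).range := fun x hx ↦
    ⟨-x, by simp [LinearMap.mem_ker.mp hx]⟩
  have := isNoetherian_of_le hle
  infer_instance

theorem cofg_range (hu : HasQuasiInverse u) : u.range.CoFG := by
  obtain ⟨v, -, huv⟩ := hu
  have := LinearMap.FiniteRangeSetoid.equiv_iff_isNoetherian_quotient_eqLocus.mp huv
  have hle : (u ∘ₗ v).eqLocus LinearMap.id ≤ u.range := fun y hy ↦ ⟨v y, hy⟩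
  have hfin : ((u ∘ₗ v).eqLocus LinearMap.id).CoFG := inferInstance
  exact hfin.of_le hle

/-- A parametrix `s` of `1 - g f` yields the parametrix `1 + f s g` of `1 - f g`. -/
theorem id_sub_comp_swap {f : M →ₗ[R] N} {g : N →ₗ[R] M}
    (h : HasQuasiInverse (LinearMap.id - g ∘ₗ f)) : HasQuasiInverse (LinearMap.id - f ∘ₗ g) := by
  obtain ⟨s, hleft, hright⟩ := h
  refine ⟨LinearMap.id + f ∘ₗ s ∘ₗ g, ?_, ?_⟩
  · calc (LinearMap.id + f ∘ₗ s ∘ₗ g) ∘ₗ (LinearMap.id - f ∘ₗ g)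
        = LinearMap.id + f ∘ₗ (s ∘ₗ (LinearMap.id - g ∘ₗ f) - LinearMap.id) ∘ₗ g := by
          simp only [LinearMap.add_comp, LinearMap.comp_sub, LinearMap.sub_comp,
            LinearMap.comp_assoc, LinearMap.id_comp, LinearMap.comp_id]
          abel
      _ ≈ LinearMap.id := by
          rw [LinearMap.FiniteRangeSetoid.equiv_iff_hasNoetherianRange, add_sub_cancel_left]
          exact ((LinearMap.FiniteRangeSetoid.equiv_iff_hasNoetherianRange.mp
            hleft).comp_right g).comp_left f
  · calc (LinearMap.id - f ∘ₗ g) ∘ₗ (LinearMap.id + f ∘ₗ s ∘ₗ g)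
        = LinearMap.id + f ∘ₗ ((LinearMap.id - g ∘ₗ f) ∘ₗ s - LinearMap.id) ∘ₗ g := by
          simp only [LinearMap.comp_add, LinearMap.comp_sub, LinearMap.sub_comp,
            LinearMap.comp_assoc, LinearMap.id_comp, LinearMap.comp_id]
          abel
      _ ≈ LinearMap.id := by
          rw [LinearMap.FiniteRangeSetoid.equiv_iff_hasNoetherianRange, add_sub_cancel_left]
          exact ((LinearMap.FiniteRangeSetoid.equiv_iff_hasNoetherianRange.mp
            hright).comp_right g).comp_left f

end HasQuasiInverse

end QuasiInverse

section FiniteRankApproximation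

variable {k : Type*} [NontriviallyNormedField k]
  {E : Type*} [NormedAddCommGroup E] [NormedSpace k E]
  {F : Type*} [NormedAddCommGroup F] [NormedSpace k F]

/-- If `‖T - S‖ < 1` then `1 - T` differs from the invertible operator `1 - (T - S)` by `S`. -/
theorem hasQuasiInverse_id_sub_of_mem_closure_hasFiniteRange [CompleteSpace E] {T : E →L[k] E}
    (hT : T ∈ closure {S : E →L[k] E | S.toLinearMap.HasFiniteRange}) :
    HasQuasiInverse (LinearMap.id - T.toLinearMap) := by
  obtain ⟨S, hS, hTS⟩ := Metric.mem_closure_iff.mp hT 1 one_pos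
  rw [dist_eq_norm] at hTS
  let e : E ≃L[k] E := ContinuousLinearEquiv.unitsEquiv k E (Units.oneSub (T - S) hTS)
  have he : LinearMap.id - T.toLinearMap ≈ e.toLinearEquiv.toLinearMap := by
    rw [LinearMap.FiniteRangeSetoid.equiv_iff_hasFiniteRange]
    have hdiff : LinearMap.id - T.toLinearMap - e.toLinearEquiv.toLinearMap = -S.toLinearMap := by
      ext x
      simp [e]
    rw [hdiff]
    exact hS.neg
  exact ⟨e.symm.toLinearMap, e.toLinearEquiv.isQuasiInverse.congr (Setoid.refl _) he⟩

theorem tendsto_sum_range_of_hasSum_apply_of_summable_norm {a : ℕ → E →L[k] F} {f : E →L[k] F}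
    (ha : Summable fun n ↦ ‖a n‖) (hf : ∀ x, HasSum (fun n ↦ a n x) (f x)) :
    Tendsto (fun N ↦ ∑ n ∈ Finset.range N, a n) atTop (𝓝 f) := by
  rw [tendsto_iff_norm_sub_tendsto_zero]
  refine squeeze_zero (fun _ ↦ norm_nonneg _) (fun N ↦ ?_) (tendsto_sum_nat_add fun n ↦ ‖a n‖)
  rw [norm_sub_rev]
  refine ContinuousLinearMap.opNorm_le_bound _ (tsum_nonneg fun _ ↦ norm_nonneg _) fun x ↦ ?_
  have htail : HasSum (fun n ↦ a (n + N) x) ((f - ∑ n ∈ Finset.range N, a n) x) := by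
    simpa [sum_apply] using (hasSum_nat_add_iff' N).mpr (hf x)
  exact htail.norm_le_of_bounded (((summable_nat_add_iff N).mpr ha).hasSum.mul_right ‖x‖)
    fun n ↦ (a (n + N)).le_opNorm x

theorem tendsto_sum_range_of_hasSum_apply_of_tendsto_norm_zero [IsUltrametricDist F]
    {a : ℕ → E →L[k] F} {f : E →L[k] F} (ha : Tendsto (fun n ↦ ‖a n‖) atTop (𝓝 0))
    (hf : ∀ x, HasSum (fun n ↦ a n x) (f x)) :
    Tendsto (fun N ↦ ∑ n ∈ Finset.range N, a n) atTop (𝓝 f) := by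
  refine Metric.nhds_basis_closedBall.tendsto_right_iff.mpr fun ε hε ↦ ?_
  obtain ⟨N₀, hN₀⟩ := eventually_atTop.mp (ha.eventually_lt_const hε)
  filter_upwards [eventually_ge_atTop N₀] with N hN
  rw [mem_closedBall_iff_norm']
  refine ContinuousLinearMap.opNorm_le_bound _ hε.le fun x ↦ ?_
  have htail : HasSum (fun n ↦ a (n + N) x) ((f - ∑ n ∈ Finset.range N, a n) x) := by
    simpa [sum_apply] using (hasSum_nat_add_iff' N).mpr (hf x)
  rw [← htail.tsum_eq]
  exact IsUltrametricDist.norm_tsum_le_of_forall_le_of_nonneg (by positivity) fun n ↦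
    (a (n + N)).le_of_opNorm_le (hN₀ (n + N) (by lia)).le x

theorem IsNuclearMap.comp {E' : Type*} [NormedAddCommGroup E'] [NormedSpace k E']
    {f : E →L[k] F} (hf : IsNuclearMap f) (g : E' →L[k] E) : IsNuclearMap (f ∘L g) := by
  obtain ⟨l, y, hly, hsum⟩ := hf
  have hle (n : ℕ) : ‖l n ∘L g‖ * ‖y n‖ ≤ ‖l n‖ * ‖y n‖ * ‖g‖ := by
    grw [ContinuousLinearMap.opNorm_comp_le, mul_right_comm]
  refine ⟨fun n ↦ l n ∘L g, y, hly.imp (fun h ↦ ?_) (fun ⟨hk, h⟩ ↦ ⟨hk, ?_⟩), fun x ↦ hsum (g x)⟩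
  · exact (h.mul_right ‖g‖).of_nonneg_of_le (fun n ↦ by positivity) hle
  · exact squeeze_zero (fun n ↦ by positivity) hle (by simpa using h.mul_const ‖g‖)

theorem IsNuclearMap.mem_closure_hasFiniteRange {f : E →L[k] F} (hf : IsNuclearMap f)
    (hF : IsUltrametricDist k → IsUltrametricDist F) :
    f ∈ closure {S : E →L[k] F | S.toLinearMap.HasFiniteRange} := by
  obtain ⟨l, y, hly, hsum⟩ := hf
  let a (n : ℕ) : E →L[k] F := (l n).smulRight (y n)
  have hnorm : (fun n ↦ ‖l n‖ * ‖y n‖) = fun n ↦ ‖a n‖ := by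
    ext n
    exact (ContinuousLinearMap.norm_smulRight_apply (l n) (y n)).symm
  rw [hnorm] at hly
  have htendsto : Tendsto (fun N ↦ ∑ n ∈ Finset.range N, a n) atTop (𝓝 f) := by
    rcases hly with habs | ⟨hk, hzero⟩
    · exact tendsto_sum_range_of_hasSum_apply_of_summable_norm habs hsum
    · have := hF hk
      exact tendsto_sum_range_of_hasSum_apply_of_tendsto_norm_zero hzero hsum
  refine mem_closure_of_tendsto htendsto (Eventually.of_forall fun N ↦ ?_)
  have hfin (n : ℕ) : (a n).toLinearMap ∈ LinearMap.finiteRange k E F := by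
    rw [LinearMap.mem_finiteRange_iff_hasFiniteRange]
    exact (LinearMap.HasFiniteRange.of_isNoetherian_rng (f := (l n).toLinearMap)).comp_left
      (LinearMap.toSpanSingleton k F (y n))
  rw [Set.mem_ofPred_eq, ← LinearMap.mem_finiteRange_iff_hasFiniteRange,
    ContinuousLinearMap.toLinearMap_sum]
  exact Submodule.sum_mem _ fun n _ ↦ hfin n

end FiniteRankApproximation

section LocalBanach

variable {k : Type*} [NontriviallyNormedField k] {V : Type*} [AddCommGroup V] [Module k V]
  {p q : Seminorm k V}

theorem LocalBanach.isUltrametricDist [IsUltrametricDist k] (hp : p.IsAdmissible) :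
    IsUltrametricDist (LocalBanach p) := by
  refine IsUltrametricDist.isUltrametricDist_of_forall_norm_add_le_max_norm fun x y ↦ ?_
  induction x, y using UniformSpace.Completion.induction_on₂ with
  | hp => exact isClosed_le (by fun_prop) (by fun_prop)
  | ih x y =>
    simp only [← UniformSpace.Completion.coe_add, UniformSpace.Completion.norm_coe]
    exact hp inferInstance x y

/-- The canonical linear map from `V` to its local Banach space at `p`; it is continuous when `p`
is, see `LocalBanach.continuous_mk`. -/
noncomputable def LocalBanach.mk (p : Seminorm k V) : V →ₗ[k] LocalBanach p :=
  (UniformSpace.Completion.toComplL : SeminormedBy p →L[k] LocalBanach p).toLinearMap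

theorem LocalBanach.continuous_mk [TopologicalSpace V] [IsTopologicalAddGroup V]
    (hp : Continuous p) : Continuous (LocalBanach.mk p) := by
  refine continuous_of_continuousAt_zero (LocalBanach.mk p) ?_
  rw [ContinuousAt, map_zero, tendsto_zero_iff_norm_tendsto_zero]
  have hnorm : (fun x : V ↦ ‖LocalBanach.mk p x‖) = p := by
    ext x
    exact UniformSpace.Completion.norm_coe (E := SeminormedBy p) x
  simpa [hnorm] using hp.tendsto 0

theorem LocalBanach.map_mk (hpq : p ≤ q) (x : V) :
    LocalBanach.map hpq (LocalBanach.mk q x) = LocalBanach.mk p x :=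
  UniformSpace.Completion.map_coe (SeminormedBy.map hpq).uniformContinuous x

theorem LocalBanach.exists_comp_mk_eq {Z : Type*} [AddCommGroup Z] [Module k Z] [UniformSpace Z]
    [IsUniformAddGroup Z] [ContinuousConstSMul k Z] [CompleteSpace Z] [T2Space Z] {f : V →ₗ[k] Z}
    (hf : IsVonNBounded k (f '' {x | p x < 1})) :
    ∃ g : LocalBanach p →L[k] Z, g.toLinearMap ∘ₗ LocalBanach.mk p = f := by
  let f₀ : SeminormedBy p →ₗ[k] Z := f
  have hf₀ : IsVonNBounded k (f₀ '' Metric.ball 0 1) := by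
    rwa [ball_zero_eq]
  let f₁ : SeminormedBy p →L[k] Z :=
    f₀.clmOfExistsBoundedImage ⟨_, Metric.ball_mem_nhds 0 one_pos, hf₀⟩
  refine ⟨f₁.extend UniformSpace.Completion.toComplL, LinearMap.ext fun x ↦ ?_⟩
  exact f₁.extend_eq UniformSpace.Completion.denseRange_coe
    (UniformSpace.Completion.isUniformInducing_coe _) x

end LocalBanach

section BoundedMaps

variable {k : Type*} [NontriviallyNormedField k]
  {X : Type*} [AddCommGroup X] [Module k X] [TopologicalSpace X]
  {F : Type*} [AddCommGroup F] [Module k F] [TopologicalSpace F]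
  {E : Type*} [SeminormedAddCommGroup E] [NormedSpace k E]

theorem exists_nhds_nhds_norm_apply_apply_le_one [IsTopologicalAddGroup X] [BaireSpace X]
    [FirstCountableTopology F] (b : X →ₗ[k] F →L[k] E) (hb : ∀ f, Continuous fun x ↦ b x f) :
    ∃ U ∈ 𝓝 (0 : X), ∃ W ∈ 𝓝 (0 : F), ∀ x ∈ U, ∀ f ∈ W, ‖b x f‖ ≤ 1 := by
  obtain ⟨W, hW⟩ := (𝓝 (0 : F)).exists_antitone_basis
  let A (n : ℕ) : Set X := {x | ∀ f ∈ W n, ‖b x f‖ ≤ 1 / 2}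
  have hA_closed (n : ℕ) : IsClosed (A n) := by
    simp only [A, Set.ofPred_forall]
    exact isClosed_iInter fun f ↦ isClosed_iInter fun _ ↦ isClosed_le (hb f).norm continuous_const
  have hA_cover : ⋃ n, A n = Set.univ := by
    refine Set.eq_univ_of_forall fun x ↦ Set.mem_iUnion.mpr ?_
    have hnhds : {f | ‖b x f‖ < 1 / 2} ∈ 𝓝 (0 : F) :=
      (isOpen_lt (b x).continuous.norm continuous_const).mem_nhds (by simp)
    obtain ⟨n, -, hn⟩ := hW.toHasBasis.mem_iff.mp hnhds
    exact ⟨n, fun f hf ↦ (hn hf).le⟩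
  obtain ⟨n, x₀, hx₀⟩ := nonempty_interior_of_iUnion_of_closed hA_closed hA_cover
  have hU : (x₀ + ·) ⁻¹' A n ∈ 𝓝 (0 : X) :=
    (continuous_const_add x₀).continuousAt.preimage_mem_nhds
      (by simpa using mem_interior_iff_mem_nhds.mp hx₀)
  refine ⟨_, hU, W n, hW.mem n, fun x hx f hf ↦ ?_⟩
  calc ‖b x f‖ = ‖b (x₀ + x) f - b x₀ f‖ := by simp
    _ ≤ ‖b (x₀ + x) f‖ + ‖b x₀ f‖ := norm_sub_le _ _
    _ ≤ 1 / 2 + 1 / 2 := add_le_add (hx f hf) (interior_subset hx₀ f hf)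
    _ = 1 := add_halves 1

theorem isVonNBounded_of_forall_norm_apply_le [IsTopologicalAddGroup F] [ContinuousSMul k F]
    {S : Set (F →L[k] E)} {W : Set F} (hW : W ∈ 𝓝 0) {C : ℝ}
    (hS : ∀ φ ∈ S, ∀ f ∈ W, ‖φ f‖ ≤ C) : IsVonNBounded k S := by
  refine ContinuousLinearMap.isVonNBounded_iff.mpr fun B hB ↦ ?_
  obtain ⟨a, ha⟩ := (hB hW).exists
  refine (NormedSpace.isVonNBounded_iff' k).mpr ⟨‖a‖ * C, ?_⟩
  rintro _ ⟨φ, hφ, f, hf, rfl⟩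
  obtain ⟨w, hw, rfl⟩ := ha hf
  simp only [map_smul, norm_smul]
  gcongr
  exact hS φ hφ w hw

end BoundedMaps

section NuclearFrechet

variable {k : Type*} [NontriviallyNormedField k]
  {X : Type*} [AddCommGroup X] [Module k X] [TopologicalSpace X]
  {Y : Type*} [AddCommGroup Y] [Module k Y] [TopologicalSpace Y]

theorem IsFrechetTVS.baireSpace (hX : IsFrechetTVS k X) : BaireSpace X := by
  have := hX.isTopologicalAddGroup
  have := hX.metrizable
  let := IsTopologicalAddGroup.rightUniformSpace X
  have := isUniformAddGroup_of_addCommGroup (G := X)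
  have := hX.complete
  have := IsUniformAddGroup.uniformity_countably_generated (α := X)
  infer_instance

theorem IsDFNSpace.exists_nhds_isVonNBounded_image (hY : IsDFNSpace k Y) (hX : IsFrechetTVS k X)
    (c : X →L[k] Y) : ∃ U ∈ 𝓝 (0 : X), IsVonNBounded k (c '' U) := by
  obtain ⟨F, _, _, _, hF, ⟨e⟩⟩ := hY
  have := hX.isTopologicalAddGroup
  have := hX.baireSpace
  have := hF.isTopologicalAddGroup
  have := hF.continuousSMul
  have := hF.metrizable
  let b : X →L[k] F →L[k] k := e.toContinuousLinearMap ∘L c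
  obtain ⟨U, hU, W, hW, hUW⟩ := exists_nhds_nhds_norm_apply_apply_le_one b.toLinearMap
    fun f ↦ (continuous_eval_const f).comp b.continuous
  have hbounded : IsVonNBounded k (b '' U) :=
    isVonNBounded_of_forall_norm_apply_le hW (Set.forall_mem_image.mpr hUW)
  refine ⟨U, hU, ?_⟩
  simpa [b, Set.image_image] using hbounded.image e.symm.toContinuousLinearMap

/-- With `K = J ∘ mk p`, the swap `1 - J ∘ mk p ↔ 1 - mk p ∘ J` reduces the claim to the local
Banach space at `p`, where `mk p ∘ J` factors through the nuclear map from the one at `q`. -/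
theorem IsNuclearTVS.hasQuasiInverse_id_sub {X : Type*} [AddCommGroup X] [Module k X]
    [UniformSpace X] [IsUniformAddGroup X] [CompleteSpace X] [T2Space X]
    (hnuc : IsNuclearTVS k X) (hX : IsLocallyConvexTVS k X) {K : X →ₗ[k] X} {U : Set X}
    (hU : U ∈ 𝓝 0) (hK : IsVonNBounded k (K '' U)) :
    HasQuasiInverse (LinearMap.id - K) := by
  have := hX.continuousSMul
  obtain ⟨p, hp, hp_cont, hpU⟩ := hX.exists_seminorm U hU
  obtain ⟨q, -, hq_cont, hpq, hmap⟩ := hnuc p hp hp_cont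
  obtain ⟨J, rfl⟩ := LocalBanach.exists_comp_mk_eq (hK.subset (Set.image_mono hpU))
  let ιq : X →L[k] LocalBanach q := ⟨LocalBanach.mk q, LocalBanach.continuous_mk hq_cont⟩
  have hT : LocalBanach.mk p ∘ₗ J.toLinearMap =
      (LocalBanach.map hpq ∘L (ιq ∘L J)).toLinearMap :=
    LinearMap.ext fun x ↦ (LocalBanach.map_mk hpq (J x)).symm
  apply HasQuasiInverse.id_sub_comp_swap
  rw [hT]
  exact hasQuasiInverse_id_sub_of_mem_closure_hasFiniteRange <|
    (hmap.comp (ιq ∘L J)).mem_closure_hasFiniteRange fun _ ↦ LocalBanach.isUltrametricDist hp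

theorem IsFNSpace.hasQuasiInverse_id_sub_comp (hX : IsFNSpace k X) (hY : IsDFNSpace k Y)
    (b : Y →L[k] X) (c : X →L[k] Y) :
    HasQuasiInverse (LinearMap.id - (b ∘L c).toLinearMap) := by
  have := hX.isTopologicalAddGroup
  have := hX.metrizable
  obtain ⟨U, hU, hc⟩ := hY.exists_nhds_isVonNBounded_image hX.toIsFrechetTVS c
  let := IsTopologicalAddGroup.rightUniformSpace X
  have := isUniformAddGroup_of_addCommGroup (G := X)
  have := hX.complete
  refine hX.nuclear.hasQuasiInverse_id_sub hX.toIsLocallyConvexTVS hU ?_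
  simpa [Set.image_image] using hc.image b

end NuclearFrechet

section Projections

variable {R V : Type*} [Ring R] [AddCommGroup V] [Module R V] {L G L' G' : Submodule R V}

theorem inf_le_ker_id_sub_projection_comp_projection (hL : IsCompl L G') (hG : IsCompl G L') :
    L ⊓ G ≤ (LinearMap.id - L.projection G' hL ∘ₗ G.projection L' hG).ker := by
  rintro x ⟨hxL, hxG⟩
  rw [LinearMap.mem_ker, LinearMap.sub_apply, LinearMap.comp_apply, LinearMap.id_apply,
    (Submodule.projection_eq_self_iff hG x).mpr hxG,
    (Submodule.projection_eq_self_iff hL x).mpr hxL, sub_self]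

theorem range_id_sub_projection_comp_projection_le_sup (hL : IsCompl L G') (hG : IsCompl G L') :
    (LinearMap.id - L'.projection G hG.symm ∘ₗ G'.projection L hL.symm).range ≤ L ⊔ G := by
  rintro _ ⟨x, rfl⟩
  have hdecomp : x - L'.projection G hG.symm (G'.projection L hL.symm x) =
      L.projection G' hL x + G.projection L' hG (G'.projection L hL.symm x) := by
    have hLx := Submodule.projection_add_projection_eq_self hL x
    have hGx := Submodule.projection_add_projection_eq_self hG (G'.projection L hL.symm x)
    grind
  simp only [LinearMap.sub_apply, LinearMap.id_apply, LinearMap.comp_apply, hdecomp]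
  exact Submodule.add_mem_sup (Submodule.projection_apply_mem hL _)
    (Submodule.projection_apply_mem hG _)

end Projections

section TateSpace

variable {k : Type*} [NontriviallyNormedField k]
  {V : Type*} [AddCommGroup V] [Module k V] [TopologicalSpace V]

theorem hasQuasiInverse_id_sub_projection_comp_projection {X Y X' Y' : Submodule k V}
    (hX : IsFNSpace k X) (hY : IsDFNSpace k Y)
    (hXX' : Submodule.IsTopCompl X X') (hYY' : Submodule.IsTopCompl Y Y') :
    HasQuasiInverse
      (LinearMap.id - X.projection X' hXX'.isCompl ∘ₗ Y.projection Y' hYY'.isCompl) :=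
  (hX.hasQuasiInverse_id_sub_comp hY (X.projectionOntoL X' hXX' ∘L Y.subtypeL)
    (Y.projectionOntoL Y' hYY' ∘L X.subtypeL)).id_sub_comp_swap (f := X.subtype)
    (g := (X.projectionOntoL X' hXX' ∘L Y.projectionL Y' hYY').toLinearMap)

theorem mainTheorem6_general [IsTopologicalAddGroup V] {L G : Submodule k V}
    (hL : IsFNLattice L) (hG : IsDFNLattice G) :
    FiniteDimensional k (L ⊓ G : Submodule k V) ∧ FiniteDimensional k (V ⧸ (L ⊔ G)) := by
  obtain ⟨hL_FN, G', hG'_DFN, hLG'⟩ := hL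
  obtain ⟨hG_DFN, L', hL'_FN, hL'G⟩ := hG
  constructor
  · have := (hasQuasiInverse_id_sub_projection_comp_projection
      hL_FN hG_DFN hLG' hL'G.symm).finite_ker
    exact Submodule.finiteDimensional_of_le
      (inf_le_ker_id_sub_projection_comp_projection hLG'.isCompl hL'G.isCompl.symm)
  · exact (hasQuasiInverse_id_sub_projection_comp_projection
      hL'_FN hG'_DFN hL'G hLG'.symm).cofg_range.of_le
      (range_id_sub_projection_comp_projection_le_sup hLG'.isCompl hL'G.isCompl.symm)

end TateSpace

theorem mainTheorem6 {k : Type*} [NontriviallyNormedField k] [IsLocalFieldCharZero k]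
    {V : Type*} [AddCommGroup V] [Module k V] [TopologicalSpace V]
    (hV : IsAnalyticTateSpace k V) (L G : Submodule k V)
    (hL : IsFNLattice L) (hG : IsDFNLattice G) :
    FiniteDimensional k (L ⊓ G : Submodule k V) ∧ FiniteDimensional k (V ⧸ (L ⊔ G)) :=
  have := hV.1.isTopologicalAddGroup
  mainTheorem6_general hL hG
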